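/- **Convergence rate for convex functions.** Let $B$ be an $n\times n$ real symmetric positive semidefinite matrix with eigenvalues $\lambda_1\ge\dots\ge\lambda_n$ and spectral decomposition $B=Q\,\mathrm{Diag}(\lambda_1,\dots,\lambda_n)\,Q^T$, $Q$ orthogonal. For a symmetric positive semidefinite matrix $M$ put $\|v\|_M:=\langle Mv,v\rangle^{1/2}$. Let $1\le\tau\le\operatorname{rank}B$, and define the $\tau$-coordinate approximation of $B$ by $$B_\tau:=Q\,\mathrm{Diag}(\lambda_1,\dots,\lambda_\tau,\lambda_\tau,\dots,\lambda_\tau)\,Q^T+\Big(\sum_{i=\tau+1}^n\lambda_i\Big)I .$$ Let $f:\mathbb R^n\to\mathbb R$ be a convex differentiable function which is 1-smooth with respect to $\|\cdot\|_B$, that is, $$f(y)\le f(x)+\langle\nabla f(x),y-x\rangle+\tfrac12\|y-x\|_B^2\qquad\text{for all }x,y\in\mathbb R^n .$$ Let $x_0\in\mathbb R^n$ be a deterministic point such that the sublevel set $L_f(x_0):=\{x\in\mathbb R^n: f(x)\le f(x_0)\}$ is bounded. For a $\tau$-element set $S\subseteq\{1,\dots,n\}$, let $I_S$ be the $n\times\tau$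 matrix formed by the columns of the identity matrix with indices in $S$, and put $B_{S\times S}:=I_S^TBI_S$ and $v_S:=I_S^Tv$. Let $K\ge1$, let $S_0,\dots,S_{K-1}$ be independent random $\tau$-element subsets of $\{1,\dots,n\}$, each with the volume sampling law $$\Pr(S_k=S)=\frac{\det B_{S\times S}}{\sum_{|S'|=\tau}\det B_{S'\times S'}},$$ and let $$x_{k+1}:=x_k-I_{S_k}(B_{S_k\times S_k})^{-1}\nabla f(x_k)_{S_k},\qquad 0\le k\le K-1$$ (randomized coordinate descent with volume sampling; the matrices $B_{S_k\times S_k}$ are non-degenerate almost surely). Then $\min f$ is attained, the minima and the maximum in $$D_\tau:=\max_{x\in L_f(x_0)}\ \min_{x^*\in\operatorname{Argmin}f}\|x-x^*\|_{B_\tau}$$ are attained, $f(x_k)$ is integrable for all $0\le k\le K$, and $$\mathbb E f(x_k)-\min f\le\frac{2D_\tau^2}{k+1}\qquad\text{for all }0\le k\le K .$$ -/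

import Mathlib

open Matrix MeasureTheory ProbabilityTheory

noncomputable section

/-- The seminorm `‖v‖_M = ⟨M v, v⟩^{1/2}` induced by a symmetric positive semidefinite matrix `M`. -/
def matSeminorm {n : ℕ} (M : Matrix (Fin n) (Fin n) ℝ) (v : EuclideanSpace ℝ (Fin n)) : ℝ :=
  Real.sqrt ((M *ᵥ v.ofLp) ⬝ᵥ v.ofLp)

/-- `f` is differentiable and 1-smooth with respect to the seminorm `‖·‖_B`. -/
structure IsOneSmooth {n : ℕ} (f : EuclideanSpace ℝ (Fin n) → ℝ)
    (B : Matrix (Fin n) (Fin n) ℝ) : Prop where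
  differentiable : Differentiable ℝ f
  upper_bound : ∀ x y, f y ≤ f x + inner ℝ (gradient f x) (y - x) + 1 / 2 * matSeminorm B (y - x) ^ 2

/-- The sublevel set `L_f(x₀) = {x | f x ≤ f x₀}`. -/
def sublevelSet {n : ℕ} (f : EuclideanSpace ℝ (Fin n) → ℝ) (x₀ : EuclideanSpace ℝ (Fin n)) :
    Set (EuclideanSpace ℝ (Fin n)) :=
  {x | f x ≤ f x₀}

/-- The set of global minimizers of `f`. -/
def argminSet {n : ℕ} (f : EuclideanSpace ℝ (Fin n) → ℝ) : Set (EuclideanSpace ℝ (Fin n)) :=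
  {z | ∀ y, f z ≤ f y}

/-- `min f`, as the infimum of the values of `f` (meaningful when it is attained). -/
def minValue {n : ℕ} (f : EuclideanSpace ℝ (Fin n) → ℝ) : ℝ :=
  sInf (Set.range f)

/-! ### Volume sampling and the coordinate descent method -/

/-- The `τ`-element subsets of the index set `Fin n`. -/
abbrev TauSubset (n τ : ℕ) : Type := {T : Finset (Fin n) // T.card = τ}

/-- The principal submatrix `B_{T × T}`. -/
def principalSubmatrix {n : ℕ} (B : Matrix (Fin n) (Fin n) ℝ) (T : Finset (Fin n)) :
    Matrix T T ℝ :=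
  B.submatrix (fun i : T => (i : Fin n)) (fun i : T => (i : Fin n))

/-- The subvector `v_T`. -/
def subvector {n : ℕ} (T : Finset (Fin n)) (v : EuclideanSpace ℝ (Fin n)) : T → ℝ :=
  fun i => v (i : Fin n)

/-- The vector `I_T h`: extension of `h` by zero outside `T`. -/
def extendByZero {n : ℕ} (T : Finset (Fin n)) (h : T → ℝ) : EuclideanSpace ℝ (Fin n) :=
  WithLp.toLp 2 (fun i => if hi : i ∈ T then h ⟨i, hi⟩ else 0)

/-- One coordinate descent update `x - I_T (B_{T × T})⁻¹ ∇f(x)_T`. -/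
def coordStep {n : ℕ} (f : EuclideanSpace ℝ (Fin n) → ℝ) (B : Matrix (Fin n) (Fin n) ℝ)
    (T : Finset (Fin n)) (x : EuclideanSpace ℝ (Fin n)) : EuclideanSpace ℝ (Fin n) :=
  x - extendByZero T ((principalSubmatrix B T)⁻¹ *ᵥ subvector T (gradient f x))

/-- The random `τ`-element subset `S` is generated according to `τ`-element volume sampling with
respect to `B`: a measurable map whose law is proportional to the principal minors. -/
structure IsVolumeSample {Ω : Type*} [MeasurableSpace Ω] (P : Measure Ω) {n : ℕ}
    (B : Matrix (Fin n) (Fin n) ℝ) (τ : ℕ) (S : Ω → TauSubset n τ) : Prop where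
  measurable : Measurable S
  law : ∀ T : TauSubset n τ, P.real {ω | S ω = T} =
    (principalSubmatrix B T.1).det / ∑ T' : TauSubset n τ, (principalSubmatrix B T'.1).det

/-- `x 0, …, x K` are the random points produced by `K` iterations of the randomized coordinate
descent method with volume sampling from the deterministic point `x₀`: at every iteration a fresh
subset of coordinates is drawn, independently of the others, by volume sampling. -/
structure IsRCDVS {Ω : Type*} [MeasurableSpace Ω] (P : Measure Ω) {n : ℕ}
    (f : EuclideanSpace ℝ (Fin n) → ℝ) (B : Matrix (Fin n) (Fin n) ℝ) (τ : ℕ)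
    (x₀ : EuclideanSpace ℝ (Fin n)) (K : ℕ) (S : Fin K → Ω → TauSubset n τ)
    (x : Fin (K + 1) → Ω → EuclideanSpace ℝ (Fin n)) : Prop where
  sample : ∀ k, IsVolumeSample P B τ (S k)
  indep : iIndepFun S P
  start : ∀ ω, x 0 ω = x₀
  step : ∀ (k : Fin K) (ω : Ω), x k.succ ω = coordStep f B (S k ω).1 (x k.castSucc ω)

/-! ### The coordinate approximation of a symmetric matrix -/

/-- For a spectral decomposition `Q diag(lam) Qᵀ` with `lam` in decreasing order (indices start at
`0`, so `lam ⟨i, _⟩` is the eigenvalue number `i + 1`), the matrix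
`Q diag(λ₁, …, λ_τ, λ_τ, …, λ_τ) Qᵀ + (∑_{i = τ + 1}^n λ_i) I`. -/
def tauApproxOf {n : ℕ} (Q : Matrix (Fin n) (Fin n) ℝ) (lam : Fin n → ℝ) (τ : ℕ) :
    Matrix (Fin n) (Fin n) ℝ :=
  Q * Matrix.diagonal
      (fun i : Fin n => lam ⟨min i.val (τ - 1), lt_of_le_of_lt (min_le_left _ _) i.isLt⟩) * Qᵀ
    + (∑ i : Fin n with τ ≤ i.val, lam i) • (1 : Matrix (Fin n) (Fin n) ℝ)

/-- The eigenvalues `λ₁ ≥ … ≥ λ_n` of a symmetric matrix, in decreasing order. -/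
def sortedEigenvalues {n : ℕ} {B : Matrix (Fin n) (Fin n) ℝ} (hB : B.IsHermitian) (i : Fin n) : ℝ :=
  hB.eigenvalues₀ (Fin.cast (Fintype.card_fin n).symm i)

/-- An orthogonal matrix whose columns are eigenvectors of a symmetric matrix, ordered as
`sortedEigenvalues`. -/
def sortedEigenvectors {n : ℕ} {B : Matrix (Fin n) (Fin n) ℝ} (hB : B.IsHermitian) :
    Matrix (Fin n) (Fin n) ℝ :=
  (hB.eigenvectorUnitary : Matrix (Fin n) (Fin n) ℝ).submatrix id
    ((finCongr (Fintype.card_fin n).symm).trans (Fintype.equivOfCardEq (Fintype.card_fin _)))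

theorem sortedEigenvalues_antitone {n : ℕ} {B : Matrix (Fin n) (Fin n) ℝ} (hB : B.IsHermitian) :
    Antitone (sortedEigenvalues hB) :=
  fun _ _ hij => hB.eigenvalues₀_antitone hij

theorem sortedEigenvectors_mul_transpose {n : ℕ} {B : Matrix (Fin n) (Fin n) ℝ}
    (hB : B.IsHermitian) : sortedEigenvectors hB * (sortedEigenvectors hB)ᵀ = 1 := by
  have h := Unitary.coe_mul_star_self hB.eigenvectorUnitary
  rw [sortedEigenvectors, Matrix.transpose_submatrix, Matrix.submatrix_mul_equiv]
  simpa [Matrix.star_eq_conjTranspose] using h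

/-- `B = Q diag(λ₁, …, λ_n) Qᵀ`, a spectral decomposition with decreasing eigenvalues. -/
theorem sorted_spectral_decomposition {n : ℕ} {B : Matrix (Fin n) (Fin n) ℝ}
    (hB : B.IsHermitian) :
    B = sortedEigenvectors hB * Matrix.diagonal (sortedEigenvalues hB)
      * (sortedEigenvectors hB)ᵀ := by
  have h := hB.spectral_theorem
  rw [Unitary.conjStarAlgAut_apply] at h
  set e : Fin n ≃ Fin n :=
    (finCongr (Fintype.card_fin n).symm).trans (Fintype.equivOfCardEq (Fintype.card_fin _)) with he
  have hd : Matrix.diagonal (sortedEigenvalues hB)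
      = (Matrix.diagonal hB.eigenvalues).submatrix e e := by
    rw [Matrix.submatrix_diagonal_equiv]
    congr 1
    funext i
    simp [sortedEigenvalues, Matrix.IsHermitian.eigenvalues, he]
  rw [sortedEigenvectors, hd, ← he, Matrix.transpose_submatrix, Matrix.submatrix_mul_equiv,
    Matrix.submatrix_mul_equiv]
  simpa [Matrix.star_eq_conjTranspose, Function.comp_def] using h

/-- The `τ`-coordinate approximation `B_τ` of a symmetric matrix `B`. -/
def tauApprox {n : ℕ} {B : Matrix (Fin n) (Fin n) ℝ} (hB : B.IsHermitian) (τ : ℕ) :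
    Matrix (Fin n) (Fin n) ℝ :=
  tauApproxOf (sortedEigenvectors hB) (sortedEigenvalues hB) τ

/-! ### The radius of a sublevel set -/

/-- `min_{z ∈ Argmin f} ‖x - z‖_M` (an infimum; meaningful when it is attained). -/
def distToArgmin {n : ℕ} (f : EuclideanSpace ℝ (Fin n) → ℝ) (M : Matrix (Fin n) (Fin n) ℝ)
    (x : EuclideanSpace ℝ (Fin n)) : ℝ :=
  sInf ((fun z => matSeminorm M (x - z)) '' argminSet f)

/-- `max_{x ∈ L_f(x₀)} min_{z ∈ Argmin f} ‖x - z‖_M` (a supremum of infima; meaningful when they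
are attained). -/
def sublevelRadius {n : ℕ} (f : EuclideanSpace ℝ (Fin n) → ℝ) (M : Matrix (Fin n) (Fin n) ℝ)
    (x₀ : EuclideanSpace ℝ (Fin n)) : ℝ :=
  sSup (distToArgmin f M '' sublevelSet f x₀)

end

/-!
Let `g = ∇f(x)` and let `e_k(λ)` be the elementary symmetric functions of the eigenvalues of `B`.
A step along `S` decreases `f` by at least half the Newton decrement `⟨(B_{S × S})⁻¹ g_S, g_S⟩`, and
`det B_{S × S} * ⟨(B_{S × S})⁻¹ g_S, g_S⟩ = det (B + g gᵀ)_{S × S} - det B_{S × S}`. Under volume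
sampling the determinants cancel, so the expected decrement is the relative change of the sum of the
principal minors of order `τ` when `B` is replaced by `B + g gᵀ`. That sum depends only on the
spectrum; in an eigenbasis of `B` its change is `∑ gᵢ² e_{τ-1}(λ without λᵢ)`. Since
`e_τ(λ) ≤ (λ_{min(i,τ)} + λ_{τ+1} + ⋯ + λ_n) e_{τ-1}(λ without λᵢ)`, Cauchy–Schwarz bounds the
expected decrement below by `⟨g, h⟩² / ‖h‖²_{B_τ}` for every `h`. With `h = x - z` for a nearest
minimizer `z`, convexity gives `(f x - min f)² ≤ 2 D_τ² (f x - 𝔼 f(x⁺))`. By Jensen the mean gaps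
`δ_k` satisfy `δ_k² ≤ 2 D_τ² (δ_k - δ_{k+1})`, which forces the `1 / (k + 1)` rate.
-/

/-! ### Elementary symmetric functions and sums of principal minors -/

section ElementarySymmetric

variable {ι R : Type*}

/-- The `k`-th elementary symmetric function of the values `x i`, `i ∈ s`. Unlike
`MvPolynomial.esymm` it lives on a varying finite set of indices, so that variables can be
deleted. -/
def esymmOn [CommSemiring R] (x : ι → R) (s : Finset ι) (k : ℕ) : R :=
  ∑ t ∈ s.powersetCard k, ∏ i ∈ t, x i

theorem coeff_prod_one_add_X_mul_C [CommSemiring R] (x : ι → R) (s : Finset ι) (k : ℕ) :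
    (∏ i ∈ s, (1 + Polynomial.X * Polynomial.C (x i))).coeff k = esymmOn x s k := by
  classical
  simp only [Finset.prod_one_add, Finset.prod_mul_distrib, Finset.prod_const, ← map_prod,
    Polynomial.finsetSum_coeff, Polynomial.coeff_X_pow_mul', Polynomial.coeff_C, esymmOn]
  rw [Finset.powersetCard_eq_filter, Finset.sum_filter]
  refine Finset.sum_congr rfl fun t _ => ?_
  split_ifs <;> first | rfl | omega

theorem esymmOn_insert_succ [CommSemiring R] [DecidableEq ι] (x : ι → R) {a : ι} {s : Finset ι}
    (ha : a ∉ s) (k : ℕ) :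
    esymmOn x (insert a s) (k + 1) = esymmOn x s (k + 1) + x a * esymmOn x s k := by
  simp_rw [← coeff_prod_one_add_X_mul_C, Finset.prod_insert ha, add_mul, one_mul, mul_assoc,
    Polynomial.coeff_add, Polynomial.coeff_X_mul, Polynomial.coeff_C_mul]

theorem esymmOn_pos [CommSemiring R] [PartialOrder R] [IsStrictOrderedRing R] {x : ι → R}
    {s t : Finset ι} (hts : t ⊆ s) (hx : ∀ i ∈ s, 0 ≤ x i) (ht : ∀ i ∈ t, 0 < x i) {k : ℕ}
    (hk : k ≤ t.card) : 0 < esymmOn x s k := by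
  obtain ⟨u, hut, hcard⟩ := Finset.exists_subset_card_eq hk
  refine (Finset.prod_pos fun i hi => ht i (hut hi)).trans_le ?_
  exact Finset.single_le_sum (f := fun u => ∏ i ∈ u, x i)
    (fun v hv => Finset.prod_nonneg fun i hi => hx i ((Finset.mem_powersetCard.mp hv).1 hi))
    (Finset.mem_powersetCard.mpr ⟨hut.trans hts, hcard⟩)

variable [CommSemiring R] [PartialOrder R] [IsOrderedRing R] {x : ι → R}

theorem esymmOn_nonneg {s : Finset ι} (hx : ∀ i ∈ s, 0 ≤ x i) (k : ℕ) : 0 ≤ esymmOn x s k :=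
  Finset.sum_nonneg fun _ ht => Finset.prod_nonneg fun _ hi =>
    hx _ ((Finset.mem_powersetCard.mp ht).1 hi)

theorem esymmOn_mono {s t : Finset ι} (hst : s ⊆ t) (hx : ∀ i ∈ t, 0 ≤ x i) (k : ℕ) :
    esymmOn x s k ≤ esymmOn x t k :=
  Finset.sum_le_sum_of_subset_of_nonneg (Finset.powersetCard_mono hst) fun _ hu _ =>
    Finset.prod_nonneg fun _ hi => hx _ ((Finset.mem_powersetCard.mp hu).1 hi)

theorem esymmOn_union_succ_le [DecidableEq ι] {s t : Finset ι} (hst : Disjoint s t)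
    (hx : ∀ i ∈ s ∪ t, 0 ≤ x i) {k : ℕ} (hs : s.card ≤ k) :
    esymmOn x (s ∪ t) (k + 1) ≤ (∑ i ∈ t, x i) * esymmOn x (s ∪ t) k := by
  induction t using Finset.induction_on with
  | empty => simp [esymmOn, Finset.powersetCard_eq_empty.mpr (Nat.lt_succ_of_le hs)]
  | insert a t hat ih =>
    rw [Finset.union_insert] at hx ⊢
    obtain ⟨has, hst⟩ := Finset.disjoint_insert_right.mp hst
    have hsub : s ∪ t ⊆ insert a (s ∪ t) := Finset.subset_insert _ _
    have hat' : a ∉ s ∪ t := Finset.notMem_union.mpr ⟨has, hat⟩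
    have hxa : 0 ≤ x a := hx a (Finset.mem_insert_self _ _)
    have hxt : 0 ≤ ∑ i ∈ t, x i :=
      Finset.sum_nonneg fun i hi => hx i (hsub (Finset.mem_union_right _ hi))
    calc esymmOn x (insert a (s ∪ t)) (k + 1)
        = esymmOn x (s ∪ t) (k + 1) + x a * esymmOn x (s ∪ t) k := esymmOn_insert_succ x hat' k
      _ ≤ (∑ i ∈ t, x i) * esymmOn x (s ∪ t) k + x a * esymmOn x (s ∪ t) k := by
          gcongr
          exact ih hst fun i hi => hx i (hsub hi)
      _ = (∑ i ∈ insert a t, x i) * esymmOn x (s ∪ t) k := by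
          rw [Finset.sum_insert hat, add_comm (x a), add_mul]
      _ ≤ (∑ i ∈ insert a t, x i) * esymmOn x (insert a (s ∪ t)) k := by
          rw [Finset.sum_insert hat]
          gcongr
          exact esymmOn_mono hsub hx k

theorem esymmOn_succ_le_sum_sdiff_mul_esymmOn_erase [DecidableEq ι] {s t : Finset ι} (hts : t ⊆ s)
    (hx : ∀ i ∈ s, 0 ≤ x i) {k : ℕ} (ht : t.card ≤ k) {a : ι} (ha : a ∈ s \ t) :
    esymmOn x s (k + 1) ≤ (∑ i ∈ s \ t, x i) * esymmOn x (s.erase a) k := by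
  obtain ⟨has, hat⟩ := Finset.mem_sdiff.mp ha
  have hsplit : t ∪ (s \ t).erase a = s.erase a := by
    rw [← Finset.erase_sdiff_comm,
      Finset.union_sdiff_of_subset (Finset.subset_erase.mpr ⟨hts, hat⟩)]
  have hle : esymmOn x (s.erase a) (k + 1)
      ≤ (∑ i ∈ (s \ t).erase a, x i) * esymmOn x (s.erase a) k := by
    rw [← hsplit]
    refine esymmOn_union_succ_le
      (Finset.disjoint_sdiff.mono_right (Finset.erase_subset _ _)) ?_ ht
    exact fun i hi => hx i (Finset.erase_subset a s (hsplit ▸ hi))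
  calc esymmOn x s (k + 1)
      = esymmOn x (s.erase a) (k + 1) + x a * esymmOn x (s.erase a) k := by
        rw [← esymmOn_insert_succ x (Finset.notMem_erase a s), Finset.insert_erase has]
    _ ≤ (∑ i ∈ (s \ t).erase a, x i) * esymmOn x (s.erase a) k + x a * esymmOn x (s.erase a) k := by
        gcongr
    _ = (∑ i ∈ s \ t, x i) * esymmOn x (s.erase a) k := by
        rw [← add_mul, Finset.sum_erase_add _ _ ha]

end ElementarySymmetric

section PrincipalMinors

variable {ι R : Type*} [DecidableEq ι] [CommRing R]

theorem one_add_X_smul_diagonal_map_C (d : ι → R) :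
    1 + (Polynomial.X : Polynomial R) • (diagonal d).map Polynomial.C
      = diagonal fun i => 1 + Polynomial.X * Polynomial.C (d i) := by
  rw [diagonal_map (map_zero _), ← diagonal_smul, ← diagonal_one, diagonal_add]
  rfl

variable [Fintype ι]

/-- The sum of the principal minors of order `k`, i.e. the `k`-th elementary symmetric function of
the eigenvalues; at `k = τ` it is the normalizing constant of `τ`-element volume sampling. -/
def sumPrincipalMinors (M : Matrix ι ι R) (k : ℕ) : R :=
  ∑ s ∈ Finset.univ.powersetCard k, (M.submatrix (Subtype.val : s → ι) Subtype.val).det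

theorem sumPrincipalMinors_eq_coeff (M : Matrix ι ι R) (k : ℕ) :
    sumPrincipalMinors M k
      = (det (1 + (Polynomial.X : Polynomial R) • M.map Polynomial.C)).coeff k :=
  (coeff_det_one_add_X_smul_eq_sum_minors M k).symm

theorem sumPrincipalMinors_mul_comm (M N : Matrix ι ι R) (k : ℕ) :
    sumPrincipalMinors (M * N) k = sumPrincipalMinors (N * M) k := by
  simp only [sumPrincipalMinors_eq_coeff, Matrix.map_mul]
  rw [← Matrix.smul_mul, det_one_add_mul_comm, Matrix.mul_smul]

theorem sumPrincipalMinors_conj {P Q : Matrix ι ι R} (hQP : Q * P = 1) (M : Matrix ι ι R) (k : ℕ) :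
    sumPrincipalMinors (P * M * Q) k = sumPrincipalMinors M k := by
  rw [Matrix.mul_assoc, sumPrincipalMinors_mul_comm, Matrix.mul_assoc, hQP, Matrix.mul_one]

theorem det_add_vecMulVec (A : Matrix ι ι R) (u v : ι → R) :
    (A + vecMulVec u v).det = A.det + v ⬝ᵥ (A.adjugate *ᵥ u) := by
  -- switch on the rows of `u vᵀ` one at a time: each new row adds `uᵢ` times the determinant of
  -- `A` with row `i` replaced by `v`
  have hrows : ∀ s : Finset ι, (A + vecMulVec (fun i => if i ∈ s then u i else 0) v).det
      = A.det + ∑ i ∈ s, u i * (A.updateRow i v).det := by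
    intro s
    induction s using Finset.induction_on with
    | empty =>
      have hzero : vecMulVec (fun _ : ι => (0 : R)) v = 0 := zero_vecMulVec v
      simp [hzero]
    | insert a s has ih =>
      set A' := A + vecMulVec (fun i => if i ∈ s then u i else 0) v with hA'
      have hupdate : A + vecMulVec (fun i => if i ∈ insert a s then u i else 0) v
          = A'.updateRow a (A' a + u a • v) := by
        ext i j
        by_cases hia : i = a <;> simp [hA', hia, has, vecMulVec_apply]
      have hreduce : (A'.updateRow a v).det = (A.updateRow a v).det := by
        refine det_eq_of_forall_row_eq_smul_add_const (fun i => if i ∈ s then u i else 0) a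
          (if_neg has) fun i j => ?_
        by_cases hia : i = a <;> simp [hA', hia, has, vecMulVec_apply]
      rw [hupdate, det_updateRow_add, updateRow_eq_self, det_updateRow_smul, hreduce, ih,
        Finset.sum_insert has, add_assoc, add_comm (u a * _)]
  have h := hrows Finset.univ
  simp only [Finset.mem_univ, if_true] at h
  rw [h, dotProduct_mulVec, ← mulVec_transpose, adjugate_transpose, ← cramer_eq_adjugate_mulVec,
    dotProduct_comm]
  simp only [dotProduct, cramer_transpose_apply]

theorem sumPrincipalMinors_diagonal (d : ι → R) (k : ℕ) :
    sumPrincipalMinors (diagonal d) k = esymmOn d Finset.univ k := by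
  rw [sumPrincipalMinors_eq_coeff, one_add_X_smul_diagonal_map_C, det_diagonal,
    coeff_prod_one_add_X_mul_C]

theorem sumPrincipalMinors_diagonal_add_vecMulVec (d u v : ι → R) (k : ℕ) :
    sumPrincipalMinors (diagonal d + vecMulVec u v) (k + 1) = esymmOn d Finset.univ (k + 1)
      + ∑ i, u i * v i * esymmOn d (Finset.univ.erase i) k := by
  have hmap : 1 + (Polynomial.X : Polynomial R) • (diagonal d + vecMulVec u v).map Polynomial.C
      = (diagonal fun i => 1 + Polynomial.X * Polynomial.C (d i))
        + vecMulVec ((Polynomial.X : Polynomial R) • (Polynomial.C ∘ u)) (Polynomial.C ∘ v) := by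
    rw [Matrix.map_add _ (map_add Polynomial.C), smul_add, ← add_assoc,
      one_add_X_smul_diagonal_map_C, smul_vecMulVec]
    congr 2
    ext i j : 2
    simp [vecMulVec_apply]
  have hdet : det (1 + (Polynomial.X : Polynomial R) •
        (diagonal d + vecMulVec u v).map Polynomial.C)
      = ∏ i, (1 + Polynomial.X * Polynomial.C (d i)) + Polynomial.X * ∑ i, Polynomial.C (u i * v i)
        * ∏ j ∈ Finset.univ.erase i, (1 + Polynomial.X * Polynomial.C (d j)) := by
    rw [hmap, det_add_vecMulVec, det_diagonal, adjugate_diagonal, mulVec_smul, dotProduct_smul,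
      smul_eq_mul]
    simp only [dotProduct, mulVec_diagonal, Function.comp_apply, map_mul]
    congr 3
    ext1 i
    ring
  rw [sumPrincipalMinors_eq_coeff, hdet, Polynomial.coeff_add, Polynomial.coeff_X_mul,
    coeff_prod_one_add_X_mul_C, Polynomial.finsetSum_coeff]
  simp only [Polynomial.coeff_C_mul, coeff_prod_one_add_X_mul_C]

end PrincipalMinors

/-! ### The matrix inequality behind the coordinate approximation -/

section SpectralDecomposition

theorem sumPrincipalMinors_eq_esymmOn_eigenvalues {ι : Type*} [Fintype ι] [DecidableEq ι]
    {M : Matrix ι ι ℝ} (hM : M.IsHermitian) (k : ℕ) :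
    sumPrincipalMinors M k = esymmOn hM.eigenvalues Finset.univ k := by
  conv_lhs => rw [hM.spectral_theorem, Unitary.conjStarAlgAut_apply]
  rw [sumPrincipalMinors_conj (Unitary.coe_star_mul_self hM.eigenvectorUnitary),
    sumPrincipalMinors_diagonal]
  rfl

theorem sumPrincipalMinors_pos {ι : Type*} [Fintype ι] [DecidableEq ι] {M : Matrix ι ι ℝ}
    (hM : M.PosSemidef) {k : ℕ} (hk : k ≤ M.rank) : 0 < sumPrincipalMinors M k := by
  rw [sumPrincipalMinors_eq_esymmOn_eigenvalues hM.isHermitian]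
  refine esymmOn_pos (Finset.subset_univ {i | hM.isHermitian.eigenvalues i ≠ 0})
    (fun i _ => hM.eigenvalues_nonneg i) (fun i hi => ?_) ?_
  · exact (hM.eigenvalues_nonneg i).lt_of_ne' (Finset.mem_filter.mp hi).2
  · rwa [← Fintype.card_subtype, ← hM.isHermitian.rank_eq_card_non_zero_eigs]

variable {n : ℕ} {B : Matrix (Fin n) (Fin n) ℝ}

/-- The `i`-th eigenvalue of the `τ`-coordinate approximation attached to eigenvalues `lam` in
decreasing order. -/
def tauEigenvalue (lam : Fin n → ℝ) (τ : ℕ) (i : Fin n) : ℝ :=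
  lam ⟨min i.val (τ - 1), (min_le_left _ _).trans_lt i.isLt⟩ + ∑ j : Fin n with τ ≤ j.val, lam j

theorem esymmOn_succ_le_tauEigenvalue_mul {lam : Fin n → ℝ} (hlam : ∀ i, 0 ≤ lam i) (k : ℕ)
    (i : Fin n) :
    esymmOn lam Finset.univ (k + 1)
      ≤ tauEigenvalue lam (k + 1) i * esymmOn lam (Finset.univ.erase i) k := by
  -- all of the `k + 1` leading indices but one
  obtain ⟨t, hit, htcard, hsum⟩ : ∃ t : Finset (Fin n), i ∉ t ∧ t.card ≤ k ∧
      ∑ j ∈ Finset.univ \ t, lam j = tauEigenvalue lam (k + 1) i := by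
    set m : Fin n := ⟨min i.val k, (min_le_left _ _).trans_lt i.isLt⟩ with hm
    refine ⟨({j | j.val < k + 1} : Finset (Fin n)).erase m, ?_, ?_, ?_⟩
    · simp [hm, Fin.ext_iff]
    · rw [Finset.card_erase_of_mem (by simp [hm]), Fin.card_filter_val_lt]
      omega
    · have hcompl : Finset.univ \ ({j | j.val < k + 1} : Finset (Fin n)).erase m
          = insert m ({j | k + 1 ≤ j.val} : Finset (Fin n)) := by
        ext j
        simp only [Finset.mem_sdiff, Finset.mem_erase, Finset.mem_insert, Finset.mem_filter_univ,
          Finset.mem_univ]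
        grind
      rw [hcompl, Finset.sum_insert (by simp [hm]), hm]
      rfl
  rw [← hsum]
  exact esymmOn_succ_le_sum_sdiff_mul_esymmOn_erase (Finset.subset_univ t) (fun j _ => hlam j)
    htcard (by simpa using hit)

theorem tauEigenvalue_nonneg {lam : Fin n → ℝ} (hlam : ∀ i, 0 ≤ lam i) (τ : ℕ) (i : Fin n) :
    0 ≤ tauEigenvalue lam τ i :=
  add_nonneg (hlam _) (Finset.sum_nonneg fun j _ => hlam j)

theorem tauApproxOf_eq {Q : Matrix (Fin n) (Fin n) ℝ} (hQ : Q * Qᵀ = 1) (lam : Fin n → ℝ) (τ : ℕ) :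
    tauApproxOf Q lam τ = Q * diagonal (tauEigenvalue lam τ) * Qᵀ := by
  have hsplit : diagonal (tauEigenvalue lam τ)
      = diagonal (fun i : Fin n => lam ⟨min i.val (τ - 1), (min_le_left _ _).trans_lt i.isLt⟩)
        + (∑ j : Fin n with τ ≤ j.val, lam j) • 1 := by
    rw [← diagonal_one, ← diagonal_smul, diagonal_add]
    congr 1
    ext i
    simp [tauEigenvalue]
  rw [hsplit, Matrix.mul_add, Matrix.add_mul, Matrix.mul_smul, Matrix.mul_one, Matrix.smul_mul, hQ,
    tauApproxOf]

theorem mul_diagonal_mul_transpose_mulVec_dotProduct {m ι R : Type*} [Fintype m] [Fintype ι]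
    [DecidableEq ι] [CommSemiring R] (Q : Matrix m ι R) (d : ι → R) (v : m → R) :
    ((Q * diagonal d * Qᵀ) *ᵥ v) ⬝ᵥ v = ∑ i, d i * (Qᵀ *ᵥ v) i ^ 2 := by
  rw [← mulVec_mulVec, ← mulVec_mulVec, dotProduct_comm, dotProduct_mulVec, ← mulVec_transpose]
  refine Finset.sum_congr rfl fun i _ => ?_
  rw [mulVec_diagonal]
  ring

theorem sortedEigenvalues_nonneg (hB : B.PosSemidef) (i : Fin n) :
    0 ≤ sortedEigenvalues hB.isHermitian i := by
  simpa [IsHermitian.eigenvalues, sortedEigenvalues] using hB.eigenvalues_nonneg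
    (Fintype.equivOfCardEq (Fintype.card_fin _) (Fin.cast (Fintype.card_fin n).symm i))

theorem tauApprox_posSemidef (hB : B.PosSemidef) (τ : ℕ) :
    (tauApprox hB.isHermitian τ).PosSemidef := by
  rw [tauApprox, tauApproxOf_eq (sortedEigenvectors_mul_transpose hB.isHermitian)]
  exact (PosSemidef.diagonal fun i => tauEigenvalue_nonneg (sortedEigenvalues_nonneg hB) τ i
    ).mul_mul_conjTranspose_same _

theorem sumPrincipalMinors_diagonal_mul_dotProduct_sq_le {lam : Fin n → ℝ} (hlam : ∀ i, 0 ≤ lam i)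
    (k : ℕ) (u v : Fin n → ℝ) :
    sumPrincipalMinors (diagonal lam) (k + 1) * (u ⬝ᵥ v) ^ 2
      ≤ (sumPrincipalMinors (diagonal lam + vecMulVec u u) (k + 1)
          - sumPrincipalMinors (diagonal lam) (k + 1))
        * ∑ i, tauEigenvalue lam (k + 1) i * v i ^ 2 := by
  rw [sumPrincipalMinors_diagonal_add_vecMulVec, sumPrincipalMinors_diagonal, add_sub_cancel_left]
  set E := esymmOn lam Finset.univ (k + 1)
  have hE : 0 ≤ E := esymmOn_nonneg (fun i _ => hlam i) _
  have hE' : ∀ i, 0 ≤ esymmOn lam (Finset.univ.erase i) k := fun i =>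
    esymmOn_nonneg (fun i _ => hlam i) _
  have hcs := Finset.sum_sq_le_sum_mul_sum_of_sq_le_mul Finset.univ (r := fun i => √E * (u i * v i))
    (f := fun i => u i * u i * esymmOn lam (Finset.univ.erase i) k)
    (g := fun i => tauEigenvalue lam (k + 1) i * v i ^ 2)
    (fun i _ => mul_nonneg (mul_self_nonneg _) (hE' i))
    (fun i _ => mul_nonneg (tauEigenvalue_nonneg hlam _ i) (sq_nonneg _)) fun i _ => by
      rw [mul_pow, Real.sq_sqrt hE]
      calc E * (u i * v i) ^ 2
          ≤ tauEigenvalue lam (k + 1) i * esymmOn lam (Finset.univ.erase i) k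
              * (u i * v i) ^ 2 := by
            gcongr
            exact esymmOn_succ_le_tauEigenvalue_mul hlam k i
        _ = _ := by ring
  rwa [← Finset.mul_sum, mul_pow, Real.sq_sqrt hE] at hcs

theorem sumPrincipalMinors_mul_dotProduct_sq_le (hB : B.PosSemidef) {τ : ℕ} (hτ : 1 ≤ τ)
    (g h : Fin n → ℝ) :
    sumPrincipalMinors B τ * (g ⬝ᵥ h) ^ 2
      ≤ (sumPrincipalMinors (B + vecMulVec g g) τ - sumPrincipalMinors B τ)
        * ((tauApprox hB.isHermitian τ *ᵥ h) ⬝ᵥ h) := by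
  obtain ⟨k, rfl⟩ := Nat.exists_eq_add_of_le' hτ
  set Q := sortedEigenvectors hB.isHermitian
  set lam := sortedEigenvalues hB.isHermitian
  have hQ : Q * Qᵀ = 1 := sortedEigenvectors_mul_transpose hB.isHermitian
  have hQ' : Qᵀ * Q = 1 := mul_eq_one_comm.mp hQ
  have hBdec : B = Q * diagonal lam * Qᵀ := sorted_spectral_decomposition hB.isHermitian
  have hdot : (Qᵀ *ᵥ g) ⬝ᵥ (Qᵀ *ᵥ h) = g ⬝ᵥ h := by
    rw [dotProduct_mulVec, vecMul_transpose, mulVec_mulVec, hQ, one_mulVec]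
  have hupdate : B + vecMulVec g g
      = Q * (diagonal lam + vecMulVec (Qᵀ *ᵥ g) (Qᵀ *ᵥ g)) * Qᵀ := by
    rw [Matrix.mul_add, Matrix.add_mul, ← hBdec, mul_vecMulVec, vecMulVec_mul, mulVec_mulVec, hQ,
      one_mulVec, vecMul_transpose, mulVec_mulVec, hQ, one_mulVec]
  have hlam := sumPrincipalMinors_diagonal_mul_dotProduct_sq_le (sortedEigenvalues_nonneg hB) k
    (Qᵀ *ᵥ g) (Qᵀ *ᵥ h)
  rw [hdot, ← mul_diagonal_mul_transpose_mulVec_dotProduct, ← tauApproxOf_eq hQ,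
    ← sumPrincipalMinors_conj hQ', ← sumPrincipalMinors_conj hQ' (_ + _), ← hupdate,
    ← hBdec] at hlam
  exact hlam

end SpectralDecomposition

/-! ### Coordinate steps and volume sampling -/

section CoordinateStep

theorem det_mul_dotProduct_inv_mulVec {ι K : Type*} [Fintype ι] [DecidableEq ι] [Field K]
    {A : Matrix ι ι K} {g : ι → K} (hg : ∀ v, A *ᵥ v = 0 → g ⬝ᵥ v = 0) :
    A.det * (g ⬝ᵥ (A⁻¹ *ᵥ g)) = (A + vecMulVec g g).det - A.det := by
  by_cases hdet : A.det = 0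
  · obtain ⟨v, hv0, hv⟩ := exists_mulVec_eq_zero_iff.mpr hdet
    have hdet' : (A + vecMulVec g g).det = 0 := by
      refine exists_mulVec_eq_zero_iff.mp ⟨v, hv0, ?_⟩
      rw [add_mulVec, hv, vecMulVec_mulVec, hg v hv, zero_add, MulOpposite.op_zero, zero_smul]
    rw [hdet, hdet', zero_mul, sub_zero]
  · rw [det_add_vecMulVec, add_sub_cancel_left, inv_def, smul_mulVec, dotProduct_smul, smul_eq_mul,
      Ring.mul_inverse_cancel_left _ _ (Ne.isUnit hdet)]

variable {n : ℕ} {B : Matrix (Fin n) (Fin n) ℝ} {f : EuclideanSpace ℝ (Fin n) → ℝ}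

theorem dotProduct_extendByZero (T : Finset (Fin n)) (a : EuclideanSpace ℝ (Fin n)) (v : T → ℝ) :
    a.ofLp ⬝ᵥ (extendByZero T v).ofLp = subvector T a ⬝ᵥ v := by
  rw [dotProduct, ← Finset.sum_subset (Finset.subset_univ T)
    (fun i _ hi => by simp [extendByZero, hi]), ← Finset.sum_coe_sort]
  exact Finset.sum_congr rfl fun i _ => by simp [extendByZero, subvector]

theorem mulVec_extendByZero (B : Matrix (Fin n) (Fin n) ℝ) (T : Finset (Fin n)) (v : T → ℝ) :
    subvector T (WithLp.toLp 2 (B *ᵥ (extendByZero T v).ofLp)) = principalSubmatrix B T *ᵥ v :=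
  funext fun i => dotProduct_extendByZero T (WithLp.toLp 2 (B i)) v

theorem mulVec_extendByZero_dotProduct_self (B : Matrix (Fin n) (Fin n) ℝ) (T : Finset (Fin n))
    (v : T → ℝ) :
    (B *ᵥ (extendByZero T v).ofLp) ⬝ᵥ (extendByZero T v).ofLp
      = (principalSubmatrix B T *ᵥ v) ⬝ᵥ v := by
  rw [← mulVec_extendByZero]
  exact dotProduct_extendByZero T (WithLp.toLp 2 _) v

/-- The squared Newton decrement `⟨(B_{T × T})⁻¹ g_T, g_T⟩` of the gradient `g` on the coordinates
`T`; it is `0`, like the inverse, when `B_{T × T}` is singular. -/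
noncomputable def coordNewtonDecrement (B : Matrix (Fin n) (Fin n) ℝ) (T : Finset (Fin n))
    (g : EuclideanSpace ℝ (Fin n)) : ℝ :=
  subvector T g ⬝ᵥ ((principalSubmatrix B T)⁻¹ *ᵥ subvector T g)

theorem coordNewtonDecrement_nonneg (hB : B.PosSemidef) (T : Finset (Fin n))
    (g : EuclideanSpace ℝ (Fin n)) : 0 ≤ coordNewtonDecrement B T g :=
  (hB.submatrix _).inv.dotProduct_mulVec_nonneg _

theorem det_principalSubmatrix_mul_coordNewtonDecrement (hB : B.PosSemidef)
    {g : EuclideanSpace ℝ (Fin n)} (hg : ∀ v, B *ᵥ v = 0 → g.ofLp ⬝ᵥ v = 0) (T : Finset (Fin n)) :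
    (principalSubmatrix B T).det * coordNewtonDecrement B T g
      = (principalSubmatrix (B + vecMulVec g g) T).det - (principalSubmatrix B T).det := by
  refine det_mul_dotProduct_inv_mulVec fun v hv => ?_
  have hker : B *ᵥ (extendByZero T v).ofLp = 0 := by
    rw [← hB.dotProduct_mulVec_zero_iff, star_trivial, dotProduct_comm,
      mulVec_extendByZero_dotProduct_self, hv, zero_dotProduct]
  rw [← dotProduct_extendByZero, hg _ hker]

theorem inner_eq_dotProduct {ι : Type*} [Fintype ι] (x y : EuclideanSpace ℝ ι) :
    inner ℝ x y = x.ofLp ⬝ᵥ y.ofLp := by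
  rw [EuclideanSpace.inner_eq_star_dotProduct, star_trivial, dotProduct_comm]

theorem matSeminorm_sq {M : Matrix (Fin n) (Fin n) ℝ} (hM : M.PosSemidef)
    (v : EuclideanSpace ℝ (Fin n)) : matSeminorm M v ^ 2 = (M *ᵥ v.ofLp) ⬝ᵥ v.ofLp := by
  rw [matSeminorm, Real.sq_sqrt]
  rw [dotProduct_comm]
  exact hM.dotProduct_mulVec_nonneg v.ofLp

theorem IsOneSmooth.gradient_dotProduct_eq_zero (hf : IsOneSmooth f B) (hB : B.PosSemidef)
    (hbelow : BddBelow (Set.range f)) (x : EuclideanSpace ℝ (Fin n)) {v : Fin n → ℝ}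
    (hv : B *ᵥ v = 0) : (gradient f x).ofLp ⬝ᵥ v = 0 := by
  obtain ⟨m, hm⟩ := hbelow
  have hline (t : ℝ) : m ≤ f x + t * ((gradient f x).ofLp ⬝ᵥ v) := by
    have h := (hm ⟨_, rfl⟩).trans (hf.upper_bound x (x + t • WithLp.toLp 2 v))
    rw [add_sub_cancel_left, matSeminorm_sq hB, inner_eq_dotProduct] at h
    simpa [mulVec_smul, hv] using h
  by_contra hne
  have h := hline (-(f x - m + 1) / ((gradient f x).ofLp ⬝ᵥ v))
  rw [div_mul_cancel₀ _ hne] at h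
  linarith

theorem IsOneSmooth.coordStep_le (hf : IsOneSmooth f B) (hB : B.PosSemidef) (T : Finset (Fin n))
    (x : EuclideanSpace ℝ (Fin n)) :
    f (coordStep f B T x) ≤ f x - 1 / 2 * coordNewtonDecrement B T (gradient f x) := by
  set g := subvector T (gradient f x) with hg
  set A := principalSubmatrix B T with hA
  set h := extendByZero T (A⁻¹ *ᵥ g) with hh
  by_cases hdet : IsUnit A.det
  · have hlinear : inner ℝ (gradient f x) h = coordNewtonDecrement B T (gradient f x) := by
      rw [inner_eq_dotProduct, hh, dotProduct_extendByZero, coordNewtonDecrement]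
    have hquadratic : matSeminorm B h ^ 2 = coordNewtonDecrement B T (gradient f x) := by
      rw [matSeminorm_sq hB, mulVec_extendByZero_dotProduct_self, ← hA, mulVec_mulVec,
        mul_nonsing_inv _ hdet, one_mulVec, coordNewtonDecrement]
    have hstep : coordStep f B T x - x = -h := sub_sub_cancel_left x h
    have hupper := hf.upper_bound x (coordStep f B T x)
    rw [hstep, inner_neg_right, hlinear, matSeminorm_sq hB, WithLp.ofLp_neg, mulVec_neg,
      neg_dotProduct_neg, ← matSeminorm_sq hB, hquadratic] at hupper
    linarith
  · have hinv : A⁻¹ = 0 := nonsing_inv_apply_not_isUnit _ hdet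
    have hh0 : h = 0 := by
      rw [hh, hinv, zero_mulVec]
      ext i
      simp [extendByZero]
    have hstep : coordStep f B T x = x := by rw [coordStep, ← hA, ← hg, ← hh, hh0, sub_zero]
    simp [hstep, coordNewtonDecrement, ← hA, hinv]

theorem IsOneSmooth.coordStep_le_self (hf : IsOneSmooth f B) (hB : B.PosSemidef)
    (T : Finset (Fin n)) (x : EuclideanSpace ℝ (Fin n)) : f (coordStep f B T x) ≤ f x :=
  (hf.coordStep_le hB T x).trans <| sub_le_self _ <|
    mul_nonneg one_half_pos.le (coordNewtonDecrement_nonneg hB T _)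

end CoordinateStep

section VolumeSampling

variable {n : ℕ} {B : Matrix (Fin n) (Fin n) ℝ} {τ : ℕ}

theorem sum_det_principalSubmatrix (B : Matrix (Fin n) (Fin n) ℝ) (τ : ℕ) :
    ∑ T : TauSubset n τ, (principalSubmatrix B T.1).det = sumPrincipalMinors B τ :=
  (Finset.sum_subtype (Finset.univ.powersetCard τ) (fun _ => Finset.mem_powersetCard_univ)
    fun T => (principalSubmatrix B T).det).symm

/-- The probability of the subset `T` in `τ`-element volume sampling. -/
noncomputable def volumeProb (B : Matrix (Fin n) (Fin n) ℝ) {τ : ℕ} (T : TauSubset n τ) : ℝ :=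
  (principalSubmatrix B T.1).det / sumPrincipalMinors B τ

theorem volumeProb_nonneg (hB : B.PosSemidef) (T : TauSubset n τ) : 0 ≤ volumeProb B T := by
  rw [volumeProb, ← sum_det_principalSubmatrix]
  exact div_nonneg (hB.submatrix _).det_nonneg
    (Finset.sum_nonneg fun T' _ => (hB.submatrix _).det_nonneg)

theorem sum_volumeProb (hB : B.PosSemidef) (hτ : τ ≤ B.rank) :
    ∑ T : TauSubset n τ, volumeProb B T = 1 := by
  simp only [volumeProb, ← Finset.sum_div, sum_det_principalSubmatrix]
  exact div_self (sumPrincipalMinors_pos hB hτ).ne'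

theorem sum_volumeProb_mul_le (hB : B.PosSemidef) (hτ : τ ≤ B.rank) {φ : TauSubset n τ → ℝ} {c : ℝ}
    (hφ : ∀ T, φ T ≤ c) : ∑ T, volumeProb B T * φ T ≤ c :=
  calc ∑ T, volumeProb B T * φ T
      ≤ ∑ T, volumeProb B T * c := by
        gcongr with T
        exacts [volumeProb_nonneg hB T, hφ T]
    _ = c := by rw [← Finset.sum_mul, sum_volumeProb hB hτ, one_mul]

theorem sumPrincipalMinors_mul_sum_volumeProb_mul_coordNewtonDecrement (hB : B.PosSemidef)
    (hτ : τ ≤ B.rank) {g : EuclideanSpace ℝ (Fin n)} (hg : ∀ v, B *ᵥ v = 0 → g.ofLp ⬝ᵥ v = 0) :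
    sumPrincipalMinors B τ * ∑ T : TauSubset n τ, volumeProb B T * coordNewtonDecrement B T.1 g
      = sumPrincipalMinors (B + vecMulVec g g) τ - sumPrincipalMinors B τ := by
  rw [Finset.mul_sum, ← sum_det_principalSubmatrix (B + _), ← sum_det_principalSubmatrix B,
    ← Finset.sum_sub_distrib]
  refine Finset.sum_congr rfl fun T _ => ?_
  rw [← det_principalSubmatrix_mul_coordNewtonDecrement hB hg, volumeProb, ← mul_assoc,
    sum_det_principalSubmatrix, mul_div_cancel₀ _ (sumPrincipalMinors_pos hB hτ).ne']

/-- The variational form of `B_τ⁻¹ ⪯ 𝔼 [I_S (B_{S × S})⁻¹ I_Sᵀ]` on the range of `B`. -/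
theorem dotProduct_sq_le_sum_volumeProb_mul_coordNewtonDecrement (hB : B.PosSemidef) (hτ : 1 ≤ τ)
    (hτB : τ ≤ B.rank) {g : EuclideanSpace ℝ (Fin n)} (hg : ∀ v, B *ᵥ v = 0 → g.ofLp ⬝ᵥ v = 0)
    (h : EuclideanSpace ℝ (Fin n)) :
    (g.ofLp ⬝ᵥ h.ofLp) ^ 2
      ≤ (∑ T : TauSubset n τ, volumeProb B T * coordNewtonDecrement B T.1 g)
        * matSeminorm (tauApprox hB.isHermitian τ) h ^ 2 := by
  refine le_of_mul_le_mul_left ?_ (sumPrincipalMinors_pos hB hτB)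
  rw [← mul_assoc, sumPrincipalMinors_mul_sum_volumeProb_mul_coordNewtonDecrement hB hτB hg,
    matSeminorm_sq (tauApprox_posSemidef hB τ)]
  exact sumPrincipalMinors_mul_dotProduct_sq_le hB hτ _ _

end VolumeSampling

section ExpectedDecrease

theorem add_inner_gradient_le_of_convexOn {E : Type*} [NormedAddCommGroup E] [InnerProductSpace ℝ E]
    [CompleteSpace E] {f : E → ℝ} (hconv : ConvexOn ℝ Set.univ f) {x : E}
    (hf : DifferentiableAt ℝ f x) (y : E) : f x + inner ℝ (gradient f x) (y - x) ≤ f y := by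
  set line : ℝ →ᵃ[ℝ] E := AffineMap.lineMap x y
  have hline0 : line 0 = x := AffineMap.lineMap_apply_zero x y
  have hline1 : line 1 = y := AffineMap.lineMap_apply_one x y
  have hderiv : HasDerivAt (f ∘ line) (inner ℝ (gradient f x) (y - x)) 0 := by
    have hgrad := hf.hasGradientAt.hasFDerivAt
    rw [← hline0] at hgrad
    simpa [hline0] using hgrad.comp_hasDerivAt (0 : ℝ) AffineMap.hasDerivAt_lineMap
  have hslope := (hconv.comp_affineMap line).le_slope_of_hasDerivAt (Set.mem_univ 0)
    (Set.mem_univ 1) one_pos hderiv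
  simp only [slope, Function.comp_apply, hline0, hline1, sub_zero, inv_one, one_smul,
    vsub_eq_sub] at hslope
  linarith

variable {n : ℕ} {B : Matrix (Fin n) (Fin n) ℝ} {f : EuclideanSpace ℝ (Fin n) → ℝ} {τ : ℕ}

/-- The conditional expectation of `f (x_{k+1})` given `x_k = x`: the mean of `f` after one
coordinate step from `x` along a `τ`-element volume sample. -/
noncomputable def expectedStepValue (f : EuclideanSpace ℝ (Fin n) → ℝ)
    (B : Matrix (Fin n) (Fin n) ℝ) (τ : ℕ) (x : EuclideanSpace ℝ (Fin n)) : ℝ :=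
  ∑ T : TauSubset n τ, volumeProb B T * f (coordStep f B T.1 x)

theorem expectedStepValue_le (hf : IsOneSmooth f B) (hB : B.PosSemidef) (hτ : τ ≤ B.rank)
    (x : EuclideanSpace ℝ (Fin n)) : expectedStepValue f B τ x ≤ f x :=
  sum_volumeProb_mul_le hB hτ fun T => hf.coordStep_le_self hB T.1 x

theorem le_expectedStepValue (hB : B.PosSemidef) (hτ : τ ≤ B.rank) {m : ℝ} (hm : ∀ y, m ≤ f y)
    (x : EuclideanSpace ℝ (Fin n)) : m ≤ expectedStepValue f B τ x := by
  have h := sum_volumeProb_mul_le hB hτ fun T => neg_le_neg (hm (coordStep f B T.1 x))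
  simp only [mul_neg, Finset.sum_neg_distrib] at h
  exact neg_le_neg_iff.mp h

theorem half_sum_volumeProb_mul_coordNewtonDecrement_le (hf : IsOneSmooth f B) (hB : B.PosSemidef)
    (hτ : τ ≤ B.rank) (x : EuclideanSpace ℝ (Fin n)) :
    1 / 2 * ∑ T : TauSubset n τ, volumeProb B T * coordNewtonDecrement B T.1 (gradient f x)
      ≤ f x - expectedStepValue f B τ x := by
  have h := sum_volumeProb_mul_le hB hτ fun T : TauSubset n τ =>
    le_sub_iff_add_le.mp (hf.coordStep_le hB T.1 x)
  simp only [mul_add, Finset.sum_add_distrib, mul_left_comm _ (1 / 2 : ℝ), ← Finset.mul_sum] at h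
  exact le_sub_iff_add_le'.mpr h

theorem sub_sq_le_mul_sub_expectedStepValue (hB : B.PosSemidef) (hconv : ConvexOn ℝ Set.univ f)
    (hf : IsOneSmooth f B) (hτ : 1 ≤ τ) (hτB : τ ≤ B.rank) {z : EuclideanSpace ℝ (Fin n)}
    (hz : z ∈ argminSet f) (x : EuclideanSpace ℝ (Fin n)) :
    (f x - f z) ^ 2 ≤ 2 * matSeminorm (tauApprox hB.isHermitian τ) (x - z) ^ 2
      * (f x - expectedStepValue f B τ x) := by
  have hbelow : BddBelow (Set.range f) := ⟨f z, Set.forall_mem_range.mpr hz⟩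
  have hgap : f x - f z ≤ inner ℝ (gradient f x) (x - z) := by
    have h := add_inner_gradient_le_of_convexOn hconv (hf.differentiable x) z
    rw [← neg_sub x z, inner_neg_right] at h
    linarith
  calc (f x - f z) ^ 2
      ≤ (inner ℝ (gradient f x) (x - z)) ^ 2 := by
        gcongr
        exact sub_nonneg.mpr (hz x)
    _ ≤ (∑ T : TauSubset n τ, volumeProb B T * coordNewtonDecrement B T.1 (gradient f x))
          * matSeminorm (tauApprox hB.isHermitian τ) (x - z) ^ 2 := by
        rw [inner_eq_dotProduct]
        exact dotProduct_sq_le_sum_volumeProb_mul_coordNewtonDecrement hB hτ hτB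
          (fun v hv => hf.gradient_dotProduct_eq_zero hB hbelow x hv) _
    _ ≤ (2 * (f x - expectedStepValue f B τ x))
          * matSeminorm (tauApprox hB.isHermitian τ) (x - z) ^ 2 := by
        gcongr
        linarith [half_sum_volumeProb_mul_coordNewtonDecrement_le hf hB hτB x]
    _ = 2 * matSeminorm (tauApprox hB.isHermitian τ) (x - z) ^ 2
          * (f x - expectedStepValue f B τ x) := by ring

end ExpectedDecrease

/-! ### Attainment of the minima and of the maximum -/

section Attainment

variable {n : ℕ} {f : EuclideanSpace ℝ (Fin n) → ℝ} {x₀ : EuclideanSpace ℝ (Fin n)}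

theorem continuous_matSeminorm (M : Matrix (Fin n) (Fin n) ℝ) : Continuous (matSeminorm M) := by
  unfold matSeminorm
  fun_prop

theorem isCompact_sublevelSet (hf : Continuous f) (hbdd : Bornology.IsBounded (sublevelSet f x₀)) :
    IsCompact (sublevelSet f x₀) :=
  Metric.isCompact_of_isClosed_isBounded (isClosed_le hf continuous_const) hbdd

theorem argminSet_nonempty (hf : Continuous f) (hbdd : Bornology.IsBounded (sublevelSet f x₀)) :
    (argminSet f).Nonempty :=
  hf.exists_forall_le' x₀ <| Filter.mem_of_superset
    (isCompact_sublevelSet hf hbdd).compl_mem_cocompact fun y hy =>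
      (not_le.mp (show ¬ f y ≤ f x₀ from hy)).le

theorem isCompact_argminSet (hf : Continuous f) (hbdd : Bornology.IsBounded (sublevelSet f x₀)) :
    IsCompact (argminSet f) := by
  refine (isCompact_sublevelSet hf hbdd).of_isClosed_subset ?_ fun z hz => hz x₀
  rw [argminSet, Set.ofPred_forall]
  exact isClosed_iInter fun y => isClosed_le hf continuous_const

theorem isLeast_range_of_mem_argminSet {z : EuclideanSpace ℝ (Fin n)} (hz : z ∈ argminSet f) :
    IsLeast (Set.range f) (f z) :=
  ⟨Set.mem_range_self z, Set.forall_mem_range.mpr hz⟩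

theorem minValue_eq {z : EuclideanSpace ℝ (Fin n)} (hz : z ∈ argminSet f) : minValue f = f z :=
  (isLeast_range_of_mem_argminSet hz).csInf_eq

theorem isLeast_minValue (hf : Continuous f) (hbdd : Bornology.IsBounded (sublevelSet f x₀)) :
    IsLeast (Set.range f) (minValue f) := by
  obtain ⟨z, hz⟩ := argminSet_nonempty hf hbdd
  exact minValue_eq hz ▸ isLeast_range_of_mem_argminSet hz

theorem isLeast_distToArgmin (hf : Continuous f) (hbdd : Bornology.IsBounded (sublevelSet f x₀))
    (M : Matrix (Fin n) (Fin n) ℝ) (x : EuclideanSpace ℝ (Fin n)) :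
    IsLeast ((fun z => matSeminorm M (x - z)) '' argminSet f) (distToArgmin f M x) :=
  ((isCompact_argminSet hf hbdd).image <|
    (continuous_matSeminorm M).comp (continuous_const.sub continuous_id)).isLeast_sInf
    ((argminSet_nonempty hf hbdd).image _)

theorem isGreatest_sublevelRadius (hf : Continuous f)
    (hbdd : Bornology.IsBounded (sublevelSet f x₀)) (M : Matrix (Fin n) (Fin n) ℝ) :
    IsGreatest (distToArgmin f M '' sublevelSet f x₀) (sublevelRadius f M x₀) := by
  have hdist : Continuous (distToArgmin f M) :=
    (isCompact_argminSet hf hbdd).continuous_sInf (f := fun x z => matSeminorm M (x - z))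
      ((continuous_matSeminorm M).comp (continuous_fst.sub continuous_snd))
  exact ((isCompact_sublevelSet hf hbdd).image hdist).isGreatest_sSup
    (Set.Nonempty.image _ ⟨x₀, le_refl (f x₀)⟩)

theorem exists_mem_argminSet_matSeminorm_le_sublevelRadius (hf : Continuous f)
    (hbdd : Bornology.IsBounded (sublevelSet f x₀)) (M : Matrix (Fin n) (Fin n) ℝ)
    {x : EuclideanSpace ℝ (Fin n)} (hx : x ∈ sublevelSet f x₀) :
    ∃ z ∈ argminSet f, matSeminorm M (x - z) ≤ sublevelRadius f M x₀ := by
  obtain ⟨z, hz, hdist⟩ := (isLeast_distToArgmin hf hbdd M x).1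
  exact ⟨z, hz, hdist.trans_le ((isGreatest_sublevelRadius hf hbdd M).2 ⟨x, hx, rfl⟩)⟩

end Attainment

section SublevelDecrease

variable {n : ℕ} {B : Matrix (Fin n) (Fin n) ℝ} {f : EuclideanSpace ℝ (Fin n) → ℝ} {τ : ℕ}
  {x₀ x : EuclideanSpace ℝ (Fin n)}

theorem sq_sub_minValue_le (hB : B.PosSemidef) (hconv : ConvexOn ℝ Set.univ f)
    (hf : IsOneSmooth f B) (hbdd : Bornology.IsBounded (sublevelSet f x₀)) (hτ : 1 ≤ τ)
    (hτB : τ ≤ B.rank) (hx : x ∈ sublevelSet f x₀) :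
    (f x - minValue f) ^ 2 ≤ 2 * sublevelRadius f (tauApprox hB.isHermitian τ) x₀ ^ 2
      * (f x - expectedStepValue f B τ x) := by
  obtain ⟨z, hz, hle⟩ := exists_mem_argminSet_matSeminorm_le_sublevelRadius
    hf.differentiable.continuous hbdd (tauApprox hB.isHermitian τ) hx
  rw [minValue_eq hz]
  refine (sub_sq_le_mul_sub_expectedStepValue hB hconv hf hτ hτB hz x).trans ?_
  have hnonneg : 0 ≤ matSeminorm (tauApprox hB.isHermitian τ) (x - z) := Real.sqrt_nonneg _
  gcongr
  exact sub_nonneg.mpr (expectedStepValue_le hf hB hτB x)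

theorem sub_minValue_le (hB : B.PosSemidef) (hconv : ConvexOn ℝ Set.univ f)
    (hf : IsOneSmooth f B) (hbdd : Bornology.IsBounded (sublevelSet f x₀)) (hτ : 1 ≤ τ)
    (hτB : τ ≤ B.rank) (hx : x ∈ sublevelSet f x₀) :
    f x - minValue f ≤ 2 * sublevelRadius f (tauApprox hB.isHermitian τ) x₀ ^ 2 := by
  have hmin (y) : minValue f ≤ f y :=
    (isLeast_minValue hf.differentiable.continuous hbdd).2 (Set.mem_range_self y)
  have hnext : minValue f ≤ expectedStepValue f B τ x := le_expectedStepValue hB hτB hmin x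
  rcases (hmin x).eq_or_lt with heq | hlt
  · rw [← heq, sub_self]
    positivity
  · refine le_of_mul_le_mul_right ?_ (sub_pos.mpr hlt)
    rw [← sq]
    refine (sq_sub_minValue_le hB hconv hf hbdd hτ hτB hx).trans ?_
    gcongr

end SublevelDecrease

/-! ### Convergence of the iterates -/

section Recurrence

variable {R : Type*} [Field R] [LinearOrder R] [IsStrictOrderedRing R] {C : R}

theorem le_div_add_one_of_sq_le_mul_sub {a b m : R} (hm : 0 < m) (hba : b ≤ a)
    (hsq : a ^ 2 ≤ C * (a - b)) (ha : a ≤ C / m) : b ≤ C / (m + 1) := by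
  rcases le_or_gt a (C / (m + 1)) with hsmall | hlarge
  · exact hba.trans hsmall
  rw [div_lt_iff₀ (by positivity)] at hlarge
  rw [le_div_iff₀ hm] at ha
  rw [le_div_iff₀ (by positivity)]
  have ha0 : 0 < a := by linarith [mul_add_one a m]
  have hC : 0 < C := (mul_pos ha0 hm).trans_le ha
  refine le_of_mul_le_mul_left ?_ hC
  calc C * (b * (m + 1)) ≤ C * a * (m + 1) - a * (a * (m + 1)) := by
        linarith [mul_le_mul_of_nonneg_right hsq (by positivity : 0 ≤ m + 1)]
    _ ≤ C * a * (m + 1) - a * C := by gcongr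
    _ = C * (a * m) := by ring
    _ ≤ C * C := by gcongr

theorem le_div_of_sq_le_mul_sub {N : ℕ} {a : Fin (N + 1) → R} (h0 : a 0 ≤ C)
    (hmono : ∀ k : Fin N, a k.succ ≤ a k.castSucc)
    (hsq : ∀ k : Fin N, a k.castSucc ^ 2 ≤ C * (a k.castSucc - a k.succ)) (k : Fin (N + 1)) :
    a k ≤ C / ((k : ℕ) + 1) := by
  induction k using Fin.induction with
  | zero => simpa using h0
  | succ k ih =>
    rw [Fin.val_succ, Nat.cast_succ]
    exact le_div_add_one_of_sq_le_mul_sub (Nat.cast_add_one_pos _) (hmono k) (hsq k) ih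

end Recurrence

section Iterates

theorem integral_comp_eq_integral_sum_of_indepFun {Ω α β : Type*} [MeasurableSpace Ω]
    {P : Measure Ω} [IsFiniteMeasure P]
    [Fintype α] [MeasurableSpace α] [MeasurableSingletonClass α]
    [Finite β] [MeasurableSpace β] [MeasurableSingletonClass β]
    {S : Ω → α} {U : Ω → β} (hS : Measurable S) (hU : Measurable U) (hSU : IndepFun S U P)
    (F : α → β → ℝ) :
    ∫ ω, F (S ω) (U ω) ∂P = ∫ ω, ∑ s, P.real {ω | S ω = s} * F s (U ω) ∂P := by
  have hlaw : P.map (fun ω => (S ω, U ω)) = (P.map S).prod (P.map U) :=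
    (indepFun_iff_map_prod_eq_prod_map_map hS.aemeasurable hU.aemeasurable).mp hSU
  have hfiber (s : α) : (P.map S).real {s} = P.real {ω | S ω = s} :=
    map_measureReal_apply hS (measurableSet_singleton s)
  calc ∫ ω, F (S ω) (U ω) ∂P
      = ∫ p, Function.uncurry F p ∂(P.map S).prod (P.map U) := by
        rw [← hlaw, integral_map (hS.prodMk hU).aemeasurable
          Measurable.of_discrete.aestronglyMeasurable]
        rfl
    _ = ∫ u, ∑ s, P.real {ω | S ω = s} * F s u ∂P.map U := by
        rw [integral_prod_symm _ Integrable.of_finite]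
        simp only [integral_fintype Integrable.of_finite, hfiber, smul_eq_mul,
          Function.uncurry_apply_pair]
    _ = ∫ ω, ∑ s, P.real {ω | S ω = s} * F s (U ω) ∂P :=
        integral_map hU.aemeasurable Measurable.of_discrete.aestronglyMeasurable

section History

/-- The values of the draws `S 0, …, S (k - 1)` made before the `k`-th iterate is formed. -/
def history {Ω α : Type*} {K : ℕ} (S : Fin K → Ω → α) (k : Fin (K + 1)) (ω : Ω) :
    ({j | j.val < k.val} : Finset (Fin K)) → α :=
  fun j => S j ω

variable {Ω α : Type*} [MeasurableSpace Ω] [MeasurableSpace α] {P : Measure Ω} {K : ℕ}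
  {S : Fin K → Ω → α}

theorem measurable_history (hS : ∀ j, Measurable (S j)) (k : Fin (K + 1)) :
    Measurable (history S k) :=
  measurable_pi_lambda _ fun j => hS j

theorem indepFun_history (hS : iIndepFun S P) (hmeas : ∀ j, Measurable (S j)) (k : Fin K) :
    IndepFun (S k) (history S k.castSucc) P :=
  (hS.indepFun_finset {k} {j | j.val < k.castSucc.val} (by simp) hmeas).comp
    (φ := fun s : ({k} : Finset (Fin K)) → α => s ⟨k, Finset.mem_singleton_self k⟩)
    (measurable_pi_apply _) measurable_id

end History

variable {Ω : Type*} [MeasurableSpace Ω] {P : Measure Ω} {n : ℕ} {B : Matrix (Fin n) (Fin n) ℝ}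
  {f : EuclideanSpace ℝ (Fin n) → ℝ} {τ : ℕ} {x₀ : EuclideanSpace ℝ (Fin n)} {K : ℕ}
  {S : Fin K → Ω → TauSubset n τ} {x : Fin (K + 1) → Ω → EuclideanSpace ℝ (Fin n)}

theorem IsVolumeSample.law_eq_volumeProb {S : Ω → TauSubset n τ} (hS : IsVolumeSample P B τ S)
    (T : TauSubset n τ) : P.real {ω | S ω = T} = volumeProb B T := by
  rw [hS.law, sum_det_principalSubmatrix, volumeProb]

namespace IsRCDVS

theorem exists_eq_comp_history (h : IsRCDVS P f B τ x₀ K S x) (k : Fin (K + 1)) :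
    ∃ G : (({j | j.val < k.val} : Finset (Fin K)) → TauSubset n τ) → EuclideanSpace ℝ (Fin n),
      ∀ ω, x k ω = G (history S k ω) := by
  induction k using Fin.induction with
  | zero => exact ⟨fun _ => x₀, h.start⟩
  | succ k ih =>
    obtain ⟨G, hG⟩ := ih
    have hlt (j : ({j | j.val < k.castSucc.val} : Finset (Fin K))) : j.1.val < k.succ.val :=
      Nat.lt_succ_of_lt ((Finset.mem_filter_univ j.1).mp j.2)
    refine ⟨fun s => coordStep f B (s ⟨k, by simp⟩).1 (G fun j => s ⟨j, by simpa using hlt j⟩), ?_⟩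
    intro ω
    rw [h.step, hG]
    rfl

theorem integrable_comp [IsFiniteMeasure P] (h : IsRCDVS P f B τ x₀ K S x) (k : Fin (K + 1))
    (φ : EuclideanSpace ℝ (Fin n) → ℝ) : Integrable (fun ω => φ (x k ω)) P := by
  obtain ⟨G, hG⟩ := h.exists_eq_comp_history k
  simp only [hG]
  exact (Integrable.of_finite (f := fun s => φ (G s))).comp_measurable
    (measurable_history (fun j => (h.sample j).measurable) k)

theorem integral_succ [IsFiniteMeasure P] (h : IsRCDVS P f B τ x₀ K S x) (k : Fin K) :
    ∫ ω, f (x k.succ ω) ∂P = ∫ ω, expectedStepValue f B τ (x k.castSucc ω) ∂P := by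
  obtain ⟨G, hG⟩ := h.exists_eq_comp_history k.castSucc
  simp only [h.step, hG, expectedStepValue, ← (h.sample k).law_eq_volumeProb]
  exact integral_comp_eq_integral_sum_of_indepFun (h.sample k).measurable
    (measurable_history (fun j => (h.sample j).measurable) _)
    (indepFun_history h.indep (fun j => (h.sample j).measurable) k)
    fun T s => f (coordStep f B T.1 (G s))

theorem mem_sublevelSet (h : IsRCDVS P f B τ x₀ K S x) (hB : B.PosSemidef) (hf : IsOneSmooth f B)
    (k : Fin (K + 1)) (ω : Ω) : x k ω ∈ sublevelSet f x₀ := by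
  induction k using Fin.induction with
  | zero => exact (congrArg f (h.start ω)).le
  | succ k ih =>
    rw [h.step]
    exact (hf.coordStep_le_self hB _ _).trans ih

theorem integral_succ_le [IsFiniteMeasure P] (h : IsRCDVS P f B τ x₀ K S x) (hB : B.PosSemidef)
    (hf : IsOneSmooth f B) (k : Fin K) :
    ∫ ω, f (x k.succ ω) ∂P ≤ ∫ ω, f (x k.castSucc ω) ∂P :=
  integral_mono (h.integrable_comp _ f) (h.integrable_comp _ f) fun ω => by
    rw [h.step]
    exact hf.coordStep_le_self hB _ _

theorem sq_integral_sub_minValue_le [IsProbabilityMeasure P] (h : IsRCDVS P f B τ x₀ K S x)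
    (hB : B.PosSemidef) (hconv : ConvexOn ℝ Set.univ f) (hf : IsOneSmooth f B)
    (hbdd : Bornology.IsBounded (sublevelSet f x₀)) (hτ : 1 ≤ τ) (hτB : τ ≤ B.rank) (k : Fin K) :
    (∫ ω, f (x k.castSucc ω) ∂P - minValue f) ^ 2
      ≤ 2 * sublevelRadius f (tauApprox hB.isHermitian τ) x₀ ^ 2
        * (∫ ω, f (x k.castSucc ω) ∂P - ∫ ω, f (x k.succ ω) ∂P) := by
  have hint := h.integrable_comp k.castSucc
  calc (∫ ω, f (x k.castSucc ω) ∂P - minValue f) ^ 2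
      = (∫ ω, (f (x k.castSucc ω) - minValue f) ∂P) ^ 2 := by
        rw [integral_sub (hint f) (integrable_const _), integral_const, probReal_univ, one_smul]
    _ ≤ ∫ ω, (f (x k.castSucc ω) - minValue f) ^ 2 ∂P :=
        even_two.convexOn_pow.map_integral_le (continuous_pow 2).continuousOn isClosed_univ
          (ae_of_all _ fun _ => Set.mem_univ _) (hint fun y => f y - minValue f)
          (hint fun y => (f y - minValue f) ^ 2)
    _ ≤ ∫ ω, 2 * sublevelRadius f (tauApprox hB.isHermitian τ) x₀ ^ 2
          * (f (x k.castSucc ω) - expectedStepValue f B τ (x k.castSucc ω)) ∂P :=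
        integral_mono (hint fun y => (f y - minValue f) ^ 2)
          (hint fun y => _ * (f y - expectedStepValue f B τ y)) fun ω =>
          sq_sub_minValue_le hB hconv hf hbdd hτ hτB (h.mem_sublevelSet hB hf _ ω)
    _ = 2 * sublevelRadius f (tauApprox hB.isHermitian τ) x₀ ^ 2
          * (∫ ω, f (x k.castSucc ω) ∂P - ∫ ω, f (x k.succ ω) ∂P) := by
        rw [integral_const_mul, integral_sub (hint f) (hint _), h.integral_succ]

end IsRCDVS

end Iterates

theorem theorem3p7 {n : ℕ} (f : EuclideanSpace ℝ (Fin n) → ℝ) (B : Matrix (Fin n) (Fin n) ℝ)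
    (hB : B.PosSemidef) (hconv : ConvexOn ℝ Set.univ f) (hsmooth : IsOneSmooth f B)
    (x₀ : EuclideanSpace ℝ (Fin n)) (hbdd : Bornology.IsBounded (sublevelSet f x₀))
    (τ : ℕ) (hτ : 1 ≤ τ) (hτB : τ ≤ B.rank) :
    -- the minima and the maximum in the claim are attained
    IsLeast (Set.range f) (minValue f) ∧
    (∀ x, IsLeast ((fun z => matSeminorm (tauApprox hB.isHermitian τ) (x - z)) '' argminSet f)
      (distToArgmin f (tauApprox hB.isHermitian τ) x)) ∧
    IsGreatest (distToArgmin f (tauApprox hB.isHermitian τ) '' sublevelSet f x₀)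
      (sublevelRadius f (tauApprox hB.isHermitian τ) x₀) ∧
    -- the convergence rate
    ∀ {Ω : Type*} [MeasurableSpace Ω] (P : Measure Ω) [IsProbabilityMeasure P]
      (K : ℕ) (_ : 1 ≤ K) (S : Fin K → Ω → TauSubset n τ)
      (x : Fin (K + 1) → Ω → EuclideanSpace ℝ (Fin n)) (_ : IsRCDVS P f B τ x₀ K S x)
      (k : Fin (K + 1)),
      Integrable (fun ω => f (x k ω)) P ∧
      (∫ ω, f (x k ω) ∂P) - minValue f
        ≤ 2 * sublevelRadius f (tauApprox hB.isHermitian τ) x₀ ^ 2 / (((k : ℕ) : ℝ) + 1) := by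
  have hcont : Continuous f := hsmooth.differentiable.continuous
  refine ⟨isLeast_minValue hcont hbdd, isLeast_distToArgmin hcont hbdd _,
    isGreatest_sublevelRadius hcont hbdd _, fun P _ K _ S x h k => ⟨h.integrable_comp k f, ?_⟩⟩
  refine le_div_of_sq_le_mul_sub (a := fun k => ∫ ω, f (x k ω) ∂P - minValue f) ?_ (fun k => ?_)
    (fun k => ?_) k
  · simp only [h.start, integral_const, probReal_univ, one_smul]
    exact sub_minValue_le hB hconv hsmooth hbdd hτ hτB (le_refl (f x₀))
  · exact sub_le_sub_right (h.integral_succ_le hB hsmooth k) _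
  · rw [sub_sub_sub_cancel_right]
    exact h.sq_integral_sub_minValue_le hB hconv hsmooth hbdd hτ hτB k
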